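/- Let $\mathcal M$ be a finite index set with $M$ elements. Let $\mathcal X$ be either a Lebesgue measurable subset of some $\mathbb R^N$ of positive measure, or a nonempty discrete set, and let $\varphi_m:\mathcal X\to\mathbb R$ ($m\in\mathcal M$) be measurable functions (in the discrete case, arbitrary functions). For $\theta\in\mathbb R^{M}$ put \[ E_\theta(x)=\sum_{m\in\mathcal M}\theta_m\varphi_m(x),\qquad Z_\theta=\int_{\mathcal X}e^{-E_\theta(x)}\,dx,\qquad \eta_m(\theta)=\frac1{Z_\theta}\int_{\mathcal X}\varphi_m(x)e^{-E_\theta(x)}\,dx , \] where for discrete $\mathcal X$ the integrals are replaced by sums over $\mathcal X$, and let $\mathcal D\subset\mathbb R^{M}$ be the set of all $\theta$ for which the integrals (sums) in $Z_\theta$ and in all $\eta_m(\theta)$ converge absolutely to finite values. Let $\Lambda_m>0$ for every $m\in\mathcal M$. Let $R=\prod_{m\in\mathcal M}[\alpha_m,\beta_m]$, with $\alpha_m\le\beta_m$, be a closed rectangle with $R\subset\mathcal D$, and suppose that each $\eta_m$ is continuous on $R$. Let $A_m,B_m\in\mathbb R$ be such that, for every $m\in\mathcal M$, $\eta_m(\theta)\ge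 A_m$ for all $\theta\in R$ with $\theta_m=\alpha_m$, and $\eta_m(\theta)\le B_m$ for all $\theta\in R$ with $\theta_m=\beta_m$. Then, for every $\mu\in\mathbb R^{M}$ with \[ B_m-\frac{\beta_m}{\Lambda_m}\le\mu_m\le A_m-\frac{\alpha_m}{\Lambda_m}\qquad\text{for all }m\in\mathcal M, \] there exists $\theta\in R$ with $\theta_m=\Lambda_m\bigl(\eta_m(\theta)-\mu_m\bigr)$ for all $m\in\mathcal M$. -/

import Mathlib

open MeasureTheory

/-- The energy `E_θ(x) = ∑ₘ θₘ φₘ(x)` of the features `φ` with parameters `θ`. -/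
def gibbsEnergy {ι X : Type*} [Fintype ι] (φ : ι → X → ℝ) (θ : ι → ℝ) (x : X) : ℝ :=
  ∑ m, θ m * φ m x

section Continuous

/-! Sample space `X ⊆ ℝᴺ` with Lebesgue measure. -/

variable {ι : Type*} [Fintype ι] {N : ℕ} {X : Set (EuclideanSpace ℝ (Fin N))}

/-- Lebesgue measure on the subset `X` of `ℝᴺ`. -/
noncomputable abbrev lebesgueOn (X : Set (EuclideanSpace ℝ (Fin N))) : Measure X :=
  Measure.comap Subtype.val volume

/-- The partition function `Z_θ = ∫_X exp(-E_θ(x)) dx`. -/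
noncomputable def gibbsPartition (φ : ι → X → ℝ) (θ : ι → ℝ) : ℝ :=
  ∫ x, Real.exp (-gibbsEnergy φ θ x) ∂lebesgueOn X

/-- The feature mean `ηₘ(θ) = (1 / Z_θ) ∫_X φₘ(x) exp(-E_θ(x)) dx`. -/
noncomputable def gibbsMean (φ : ι → X → ℝ) (m : ι) (θ : ι → ℝ) : ℝ :=
  1 / gibbsPartition φ θ * ∫ x, φ m x * Real.exp (-gibbsEnergy φ θ x) ∂lebesgueOn X

/-- The parameters for which the integrals in `Z_θ` and in every `ηₘ(θ)` are finite. -/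
def gibbsDomain (φ : ι → X → ℝ) : Set (ι → ℝ) :=
  {θ | Integrable (fun x => Real.exp (-gibbsEnergy φ θ x)) (lebesgueOn X) ∧
    ∀ m, Integrable (fun x => φ m x * Real.exp (-gibbsEnergy φ θ x)) (lebesgueOn X)}

end Continuous

section Discrete

/-! Discrete sample space `X`, with sums in place of integrals. -/

variable {ι X : Type*} [Fintype ι]

/-- The partition function `Z_θ = ∑_{x ∈ X} exp(-E_θ(x))`. -/
noncomputable def discreteGibbsPartition (φ : ι → X → ℝ) (θ : ι → ℝ) : ℝ :=
  ∑' x, Real.exp (-gibbsEnergy φ θ x)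

/-- The feature mean `ηₘ(θ) = (1 / Z_θ) ∑_{x ∈ X} φₘ(x) exp(-E_θ(x))`. -/
noncomputable def discreteGibbsMean (φ : ι → X → ℝ) (m : ι) (θ : ι → ℝ) : ℝ :=
  1 / discreteGibbsPartition φ θ * ∑' x, φ m x * Real.exp (-gibbsEnergy φ θ x)

/-- The parameters for which the sums in `Z_θ` and in every `ηₘ(θ)` converge (absolutely). -/
def discreteGibbsDomain (φ : ι → X → ℝ) : Set (ι → ℝ) :=
  {θ | Summable (fun x => Real.exp (-gibbsEnergy φ θ x)) ∧
    ∀ m, Summable (fun x => φ m x * Real.exp (-gibbsEnergy φ θ x))}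

end Discrete

/-- A function with a continuous subgradient `-η` on a set is continuous there. -/
theorem continuousOn_of_continuousOn_subgradient {ι : Type*} [Fintype ι] {s : Set (ι → ℝ)}
    {L : (ι → ℝ) → ℝ} {η : ι → (ι → ℝ) → ℝ} (hη : ∀ m, ContinuousOn (η m) s)
    (hL : ∀ θ ∈ s, ∀ θ' ∈ s, L θ' + ∑ m, η m θ' * (θ' m - θ m) ≤ L θ) :
    ContinuousOn L s := by
  intro θ hθ
  have hcoord : ∀ m, ContinuousWithinAt (fun θ' : ι → ℝ => θ' m) s θ := fun m =>
    (continuous_apply m).continuousWithinAt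
  have hlo : Filter.Tendsto (fun θ' => L θ + ∑ m, η m θ * (θ m - θ' m))
      (nhdsWithin θ s) (nhds (L θ)) := by
    have : ContinuousWithinAt (fun θ' => L θ + ∑ m, η m θ * (θ m - θ' m)) s θ :=
      continuousWithinAt_const.add <| tendsto_finsetSum _ fun m _ =>
        continuousWithinAt_const.mul (continuousWithinAt_const.sub (hcoord m))
    simpa [ContinuousWithinAt] using this
  have hhi : Filter.Tendsto (fun θ' => L θ - ∑ m, η m θ' * (θ' m - θ m))
      (nhdsWithin θ s) (nhds (L θ)) := by
    have : ContinuousWithinAt (fun θ' => L θ - ∑ m, η m θ' * (θ' m - θ m)) s θ :=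
      continuousWithinAt_const.sub <| tendsto_finsetSum _ fun m _ =>
        (hη m θ hθ).mul ((hcoord m).sub continuousWithinAt_const)
    simpa [ContinuousWithinAt] using this
  refine tendsto_of_tendsto_of_tendsto_of_le_of_le' hlo hhi ?_ ?_
  · filter_upwards [self_mem_nhdsWithin] with θ' hθ'
    exact hL θ' hθ' θ hθ
  · filter_upwards [self_mem_nhdsWithin] with θ' hθ'
    linarith [hL θ hθ θ' hθ']

/-- Existence of a zero of `η m θ - μ m - θ m / Λ m` on a box, where `-η` is a continuous
subgradient and the sign conditions hold on opposite faces. The zero minimises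
`L θ + ∑ m, (μ m * θ m + θ m ^ 2 / (2 * Λ m))`. -/
theorem exists_eq_mul_sub_of_subgradient {ι : Type*} [Fintype ι] {Λ : ι → ℝ}
    (hΛ : ∀ m, 0 < Λ m) {α β : ι → ℝ} (hαβ : α ≤ β)
    {L : (ι → ℝ) → ℝ} {η : ι → (ι → ℝ) → ℝ} (hη : ∀ m, ContinuousOn (η m) (Set.Icc α β))
    (hL : ∀ θ ∈ Set.Icc α β, ∀ θ' ∈ Set.Icc α β,
      L θ' + ∑ m, η m θ' * (θ' m - θ m) ≤ L θ) (μ : ι → ℝ)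
    (hlo : ∀ m, ∀ θ ∈ Set.Icc α β, θ m = α m → α m ≤ Λ m * (η m θ - μ m))
    (hhi : ∀ m, ∀ θ ∈ Set.Icc α β, θ m = β m → Λ m * (η m θ - μ m) ≤ β m) :
    ∃ θ ∈ Set.Icc α β, ∀ m, θ m = Λ m * (η m θ - μ m) := by
  classical
  have hLc := continuousOn_of_continuousOn_subgradient hη hL
  have hGc : ContinuousOn (fun θ => L θ + ∑ m, (μ m * θ m + θ m ^ 2 / (2 * Λ m)))
      (Set.Icc α β) := by
    refine hLc.add (Continuous.continuousOn ?_)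
    fun_prop
  obtain ⟨θ, hθ, hmin⟩ := isCompact_Icc.exists_isMinOn (Set.nonempty_Icc.2 hαβ) hGc
  refine ⟨θ, hθ, fun m => ?_⟩
  -- Comparing the minimiser with its perturbation in one coordinate.
  have hstep : ∀ s, α m ≤ s → s ≤ β m →
      0 ≤ (s - θ m) * (μ m - η m (Function.update θ m s) + (s + θ m) / (2 * Λ m)) := by
    intro s hs₁ hs₂
    have hmem : Function.update θ m s ∈ Set.Icc α β := by
      constructor
      · exact le_update_iff.2 ⟨hs₁, fun j _ => hθ.1 j⟩
      · exact update_le_iff.2 ⟨hs₂, fun j _ => hθ.2 j⟩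
    have h1 := hmin hmem
    have h2 := hL θ hθ _ hmem
    have e2 : ∑ j, η j (Function.update θ m s) * (Function.update θ m s j - θ j)
        = η m (Function.update θ m s) * (s - θ m) := by
      rw [Finset.sum_eq_single m]
      · simp
      · intro j _ hj
        simp [hj]
      · simp
    have e1 : ∑ j, (μ j * Function.update θ m s j + Function.update θ m s j ^ 2 / (2 * Λ j))
        - ∑ j, (μ j * θ j + θ j ^ 2 / (2 * Λ j))
        = (μ m * s + s ^ 2 / (2 * Λ m)) - (μ m * θ m + θ m ^ 2 / (2 * Λ m)) := by
      rw [← Finset.sum_sub_distrib, Finset.sum_eq_single m]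
      · simp
      · intro j _ hj
        simp [hj]
      · simp
    simp only [Set.mem_ofPred_eq] at h1
    rw [e2] at h2
    have e3 : (s - θ m) * (μ m - η m (Function.update θ m s) + (s + θ m) / (2 * Λ m))
        = (μ m * s + s ^ 2 / (2 * Λ m)) - (μ m * θ m + θ m ^ 2 / (2 * Λ m))
          - η m (Function.update θ m s) * (s - θ m) := by
      ring
    linarith
  have hlim : ContinuousOn
      (fun s => μ m - η m (Function.update θ m s) + (s + θ m) / (2 * Λ m))
      (Set.Icc (α m) (β m)) := by
    have : ContinuousOn (fun s => η m (Function.update θ m s)) (Set.Icc (α m) (β m)) := by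
      refine (hη m).comp (t := Set.Icc α β)
        (Continuous.continuousOn (continuous_const.update (f := fun _ : ℝ => θ) m continuous_id))
        fun s hs => ?_
      exact ⟨le_update_iff.2 ⟨hs.1, fun j _ => hθ.1 j⟩, update_le_iff.2 ⟨hs.2, fun j _ => hθ.2 j⟩⟩
    exact (continuousOn_const.sub this).add (Continuous.continuousOn (by fun_prop))
  have hlim' := hlim (θ m) ⟨hθ.1 m, hθ.2 m⟩
  have hval : μ m - η m (Function.update θ m (θ m)) + (θ m + θ m) / (2 * Λ m)
      = (θ m - Λ m * (η m θ - μ m)) / Λ m := by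
    have := (hΛ m).ne'
    rw [Function.update_eq_self]
    field_simp
    ring
  simp only [ContinuousWithinAt, hval] at hlim'
  apply le_antisymm
  · rcases (hθ.1 m).eq_or_lt with h | h
    · rw [← h]
      exact hlo m θ hθ h.symm
    · have hT := hlim'.mono_left (nhdsWithin_mono _
        (show Set.Ico (α m) (θ m) ⊆ Set.Icc (α m) (β m) from
          fun s hs => ⟨hs.1, hs.2.le.trans (hθ.2 m)⟩))
      have : (nhdsWithin (θ m) (Set.Ico (α m) (θ m))).NeBot := by
        rw [nhdsWithin_Ico_eq_nhdsLT h]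
        infer_instance
      have := le_of_tendsto hT (b := 0) (by
        filter_upwards [self_mem_nhdsWithin] with s hs
        have := hstep s hs.1 (hs.2.le.trans (hθ.2 m))
        by_contra! hcon
        exact absurd this (not_le.2 (mul_neg_of_neg_of_pos (sub_neg.2 hs.2) hcon)))
      have := (div_le_iff₀ (hΛ m)).1 this
      linarith
  · rcases (hθ.2 m).eq_or_lt with h | h
    · rw [h]
      exact hhi m θ hθ h
    · have hT := hlim'.mono_left (nhdsWithin_mono _
        (show Set.Ioc (θ m) (β m) ⊆ Set.Icc (α m) (β m) from
          fun s hs => ⟨(hθ.1 m).trans hs.1.le, hs.2⟩))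
      have : (nhdsWithin (θ m) (Set.Ioc (θ m) (β m))).NeBot := by
        rw [nhdsWithin_Ioc_eq_nhdsGT h]
        infer_instance
      have := ge_of_tendsto hT (b := 0) (by
        filter_upwards [self_mem_nhdsWithin] with s hs
        exact nonneg_of_mul_nonneg_right (hstep s ((hθ.1 m).trans hs.1.le) hs.2)
          (sub_pos.2 hs.1))
      have := (le_div_iff₀ (hΛ m)).1 this
      linarith

/-- The version of `exists_eq_mul_sub_of_subgradient` for a log-partition function, in terms of
the Gibbs inequality for the partition function `Z`. -/
theorem exists_eq_mul_sub_of_gibbs_inequality {ι : Type*} [Fintype ι] {Λ : ι → ℝ}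
    (hΛ : ∀ m, 0 < Λ m) {α β : ι → ℝ} (hαβ : ∀ m, α m ≤ β m) {A B : ι → ℝ}
    {Z : (ι → ℝ) → ℝ} {η : ι → (ι → ℝ) → ℝ}
    (hZ : ∀ θ, 0 ≤ Z θ) (hZη : ∀ m θ, Z θ = 0 → η m θ = 0)
    (hJ : ∀ θ ∈ Set.Icc α β, ∀ θ' ∈ Set.Icc α β,
      Z θ' * Real.exp (∑ m, η m θ' * (θ' m - θ m)) ≤ Z θ)
    (hη : ∀ m, ContinuousOn (η m) (Set.Icc α β))
    (hA : ∀ m, ∀ θ ∈ Set.Icc α β, θ m = α m → A m ≤ η m θ)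
    (hB : ∀ m, ∀ θ ∈ Set.Icc α β, θ m = β m → η m θ ≤ B m) {μ : ι → ℝ}
    (hμ : ∀ m, B m - β m / Λ m ≤ μ m ∧ μ m ≤ A m - α m / Λ m) :
    ∃ θ ∈ Set.Icc α β, ∀ m, θ m = Λ m * (η m θ - μ m) := by
  refine exists_eq_mul_sub_of_subgradient (L := fun θ => Real.log (Z θ)) hΛ hαβ hη ?_ μ ?_ ?_
  · intro θ hθ θ' hθ'
    rcases (hZ θ').eq_or_lt with h | h
    · have h0 : Z θ = 0 := by
        have h1 := hJ θ' hθ' θ hθ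
        rw [← h] at h1
        exact le_antisymm (nonpos_of_mul_nonpos_left h1 (Real.exp_pos _)) (hZ θ)
      simp [← h, h0, fun m => hZη m θ' h.symm]
    · have h1 := Real.log_le_log (mul_pos h (Real.exp_pos _)) (hJ θ hθ θ' hθ')
      rwa [Real.log_mul h.ne' (Real.exp_ne_zero _), Real.log_exp] at h1
  · intro m θ hθ h
    rw [← div_le_iff₀' (hΛ m)]
    linarith [hA m θ hθ h, (hμ m).2]
  · intro m θ hθ h
    rw [← le_div_iff₀' (hΛ m)]
    linarith [hB m θ hθ h, (hμ m).1]

/-- The tangent-line bound for the Boltzmann weight `exp (-E_θ)` in terms of `exp (-E_θ')`. -/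
theorem tangent_le_exp_neg_gibbsEnergy {ι X : Type*} [Fintype ι] (φ : ι → X → ℝ)
    (θ θ' : ι → ℝ) (c : ℝ) (x : X) :
    Real.exp c * (1 - c) * Real.exp (-gibbsEnergy φ θ' x)
      + ∑ m, Real.exp c * (θ' m - θ m) * (φ m x * Real.exp (-gibbsEnergy φ θ' x))
      ≤ Real.exp (-gibbsEnergy φ θ x) := by
  have hs : ∑ m, Real.exp c * (θ' m - θ m) * (φ m x * Real.exp (-gibbsEnergy φ θ' x))
      = Real.exp c * Real.exp (-gibbsEnergy φ θ' x)
        * (gibbsEnergy φ θ' x - gibbsEnergy φ θ x) := by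
    rw [gibbsEnergy, gibbsEnergy, ← Finset.sum_sub_distrib, Finset.mul_sum]
    exact Finset.sum_congr rfl fun m _ => by ring
  have he : Real.exp (-gibbsEnergy φ θ x) = Real.exp c * Real.exp (-gibbsEnergy φ θ' x)
      * Real.exp (gibbsEnergy φ θ' x - gibbsEnergy φ θ x - c) := by
    rw [← Real.exp_add, ← Real.exp_add]
    congr 1
    ring
  rw [hs, he]
  have := mul_le_mul_of_nonneg_left
    (Real.add_one_le_exp (gibbsEnergy φ θ' x - gibbsEnergy φ θ x - c))
    (mul_pos (Real.exp_pos c) (Real.exp_pos (-gibbsEnergy φ θ' x))).le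
  linarith

/-- The tangent-line bound integrated, with the slope chosen to be the mean, is the Gibbs
inequality. -/
theorem mul_exp_le_of_tangent_le {ι : Type*} [Fintype ι] {Z Z' : ℝ} {S d : ι → ℝ} (hZ : 0 ≤ Z)
    (h : ∀ c, Real.exp c * (1 - c) * Z' + ∑ m, Real.exp c * d m * S m ≤ Z) :
    Z' * Real.exp (∑ m, 1 / Z' * S m * d m) ≤ Z := by
  rcases eq_or_ne Z' 0 with h0 | h0
  · simpa [h0] using hZ
  · refine le_trans (le_of_eq ?_) (h (∑ m, 1 / Z' * S m * d m))
    have : ∑ m, Real.exp (∑ m, 1 / Z' * S m * d m) * d m * S m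
        = Real.exp (∑ m, 1 / Z' * S m * d m) * (Z' * ∑ m, 1 / Z' * S m * d m) := by
      rw [Finset.mul_sum, Finset.mul_sum]
      refine Finset.sum_congr rfl fun m _ => ?_
      field_simp
    rw [this]
    ring

theorem gibbsPartition_mul_exp_le {ι : Type*} [Fintype ι] {N : ℕ}
    {X : Set (EuclideanSpace ℝ (Fin N))} {φ : ι → X → ℝ} {θ θ' : ι → ℝ}
    (hθ : θ ∈ gibbsDomain φ) (hθ' : θ' ∈ gibbsDomain φ) :
    gibbsPartition φ θ' * Real.exp (∑ m, gibbsMean φ m θ' * (θ' m - θ m))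
      ≤ gibbsPartition φ θ := by
  refine mul_exp_le_of_tangent_le (integral_nonneg fun x => (Real.exp_pos _).le) fun c => ?_
  have h1 := hθ'.1.const_mul (Real.exp c * (1 - c))
  have h2 := fun m => (hθ'.2 m).const_mul (Real.exp c * (θ' m - θ m))
  have := integral_mono (h1.add (integrable_finsetSum Finset.univ fun m _ => h2 m)) hθ.1
    fun x => by simpa using tangent_le_exp_neg_gibbsEnergy φ θ θ' c x
  rw [integral_add' h1 (integrable_finsetSum Finset.univ fun m _ => h2 m),
    integral_finsetSum _ fun m _ => h2 m] at this
  simpa only [integral_const_mul, gibbsPartition] using this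

theorem discreteGibbsPartition_mul_exp_le {ι X : Type*} [Fintype ι] {φ : ι → X → ℝ}
    {θ θ' : ι → ℝ} (hθ : θ ∈ discreteGibbsDomain φ) (hθ' : θ' ∈ discreteGibbsDomain φ) :
    discreteGibbsPartition φ θ' * Real.exp (∑ m, discreteGibbsMean φ m θ' * (θ' m - θ m))
      ≤ discreteGibbsPartition φ θ := by
  refine mul_exp_le_of_tangent_le (tsum_nonneg fun x => (Real.exp_pos _).le) fun c => ?_
  exact hasSum_le (tangent_le_exp_neg_gibbsEnergy φ θ θ' c)
    ((hθ'.1.hasSum.mul_left _).add (hasSum_sum fun m _ => (hθ'.2 m).hasSum.mul_left _))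
    hθ.1.hasSum

theorem theorem1 {ι : Type*} [Fintype ι] (Λ : ι → ℝ) (hΛ : ∀ m, 0 < Λ m)
    (α β : ι → ℝ) (hαβ : ∀ m, α m ≤ β m) (A B : ι → ℝ) :
    -- sample space a (Lebesgue) measurable subset of a Euclidean space
    (∀ (N : ℕ) (X : Set (EuclideanSpace ℝ (Fin N))), NullMeasurableSet X volume →
      ∀ φ : ι → X → ℝ, (∀ m, AEMeasurable (φ m) (lebesgueOn X)) →
        Set.Icc α β ⊆ gibbsDomain φ →
        (∀ m, ContinuousOn (gibbsMean φ m) (Set.Icc α β)) →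
        (∀ m, ∀ θ ∈ Set.Icc α β, θ m = α m → A m ≤ gibbsMean φ m θ) →
        (∀ m, ∀ θ ∈ Set.Icc α β, θ m = β m → gibbsMean φ m θ ≤ B m) →
        ∀ μ : ι → ℝ, (∀ m, B m - β m / Λ m ≤ μ m ∧ μ m ≤ A m - α m / Λ m) →
          ∃ θ ∈ Set.Icc α β, ∀ m, θ m = Λ m * (gibbsMean φ m θ - μ m)) ∧
    -- discrete sample space
    (∀ (X : Type*) (φ : ι → X → ℝ),
        Set.Icc α β ⊆ discreteGibbsDomain φ →
        (∀ m, ContinuousOn (discreteGibbsMean φ m) (Set.Icc α β)) →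
        (∀ m, ∀ θ ∈ Set.Icc α β, θ m = α m → A m ≤ discreteGibbsMean φ m θ) →
        (∀ m, ∀ θ ∈ Set.Icc α β, θ m = β m → discreteGibbsMean φ m θ ≤ B m) →
        ∀ μ : ι → ℝ, (∀ m, B m - β m / Λ m ≤ μ m ∧ μ m ≤ A m - α m / Λ m) →
          ∃ θ ∈ Set.Icc α β, ∀ m, θ m = Λ m * (discreteGibbsMean φ m θ - μ m)) := by
  refine ⟨fun N X _ φ _ hR hη hA hB μ hμ => ?_, fun X φ hR hη hA hB μ hμ => ?_⟩
  · exact exists_eq_mul_sub_of_gibbs_inequality (Z := gibbsPartition φ) hΛ hαβ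
      (fun θ => integral_nonneg fun x => (Real.exp_pos _).le)
      (fun m θ h => by simp [gibbsMean, h])
      (fun θ hθ θ' hθ' => gibbsPartition_mul_exp_le (hR hθ) (hR hθ')) hη hA hB hμ
  · exact exists_eq_mul_sub_of_gibbs_inequality (Z := discreteGibbsPartition φ) hΛ hαβ
      (fun θ => tsum_nonneg fun x => (Real.exp_pos _).le)
      (fun m θ h => by simp [discreteGibbsMean, h])
      (fun θ hθ θ' hθ' => discreteGibbsPartition_mul_exp_le (hR hθ) (hR hθ')) hη hA hB hμ
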